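/- Let $G$ be a finitely generated torsion-free nilpotent group. A virtual endomorphism of $G$ is a homomorphism $f:K\to G$ defined on a subgroup $K\leqslant G$ of finite index; it is called recurrent if it is surjective, and simple if the only subgroup $N\leqslant K$ that is normal in $G$ and satisfies $f(N)\leqslant N$ is the trivial one. Suppose that $G$ is strongly recurrent self-similar, that is, for every subgroup $H$ of finite index in $G$ there are a subgroup $K$ of finite index in $H$ and a simple recurrent virtual endomorphism $f:K\to G$. Then $G$ is geometrically equivalent to its Malcev completion $G^{\ast}$. Here $G^{\ast}$ is the torsion-free nilpotent group containing $G$ (it exists and is unique up to isomorphism over $G$) in which every element has an $n$-th root for every $n\geq 1$ and every element has a positive power lying in $G$. Two groups $G_1$ and $G_2$ are geometrically equivalent if for every free group $F$ of finite rank and every subset $S\subseteq F$ the set $S$ is $G_1$-closed if and only if it is $G_2$-closed, where $S$ is called $G_i$-closed if $S$ equals the intersection of the kernels of all homomorphisms $\sigma:F\to G_i$ with $S\subseteq\ker\sigma$. -/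

import Mathlib

universe u v

/-- The group `G` is torsion-free: only the identity has finite order. -/
def TorsionFreeGroup (G : Type*) [Group G] : Prop :=
  ∀ g : G, IsOfFinOrder g → g = 1

/-- The `f`-core of `K` for a homomorphism `f : K → G` defined on a subgroup `K` of `G`: the subgroup
generated by all subgroups of `K` that are normal in `G` and `f`-invariant. -/
def virtualCore {G : Type*} [Group G] (K : Subgroup G) (f : K →* G) : Subgroup G :=
  sSup {N : Subgroup G | N ≤ K ∧ N.Normal ∧ ∀ x : K, (x : G) ∈ N → f x ∈ N}

/-- A homomorphism `f : K → G` defined on a subgroup of `G` is simple if its core is trivial. -/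
def IsSimpleVirtualEndo {G : Type*} [Group G] (K : Subgroup G) (f : K →* G) : Prop :=
  virtualCore K f = ⊥

/-- `G` is strongly recurrent self-similar: every finite-index subgroup `H` of `G` contains a
finite-index subgroup `K` with a simple recurrent (that is, surjective) virtual endomorphism
`f : K → G`. As `H` has finite index in `G`, the index of `K` in `H` is finite if and only if its
index in `G` is. -/
def IsStronglyRecurrentSelfSimilar (G : Type*) [Group G] : Prop :=
  ∀ H : Subgroup G, H.FiniteIndex →
    ∃ K : Subgroup G, K ≤ H ∧ K.FiniteIndex ∧
      ∃ f : K →* G, Function.Surjective f ∧ IsSimpleVirtualEndo K f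

/-- For a subset `S` of a group `F`, the set of homomorphisms `F → G` whose kernel contains `S`. -/
def homsKilling {F : Type*} [Group F] (G : Type*) [Group G] (S : Set F) : Set (F →* G) :=
  {σ | S ⊆ (σ.ker : Set F)}

/-- The intersection of the kernels of all homomorphisms in `T` (the whole of `F` if `T = ∅`). -/
def commonKernel {F G : Type*} [Group F] [Group G] (T : Set (F →* G)) : Set F :=
  ⋂ σ ∈ T, (σ.ker : Set F)

/-- A subset `S` of `F` is `G`-closed if it equals its double closure. -/
def IsGroupClosed {F : Type*} [Group F] (G : Type*) [Group G] (S : Set F) : Prop :=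
  S = commonKernel (homsKilling G S)

/-- Geometric equivalence of groups in the sense of Plotkin: for every free group `F` of finite rank,
the `G₁`-closed and the `G₂`-closed subsets of `F` are the same. -/
def GeometricallyEquivalent (G₁ G₂ : Type*) [Group G₁] [Group G₂] : Prop :=
  ∀ (n : ℕ) (S : Set (FreeGroup (Fin n))), IsGroupClosed G₁ S ↔ IsGroupClosed G₂ S

/-- `ι : G → M` is a (rational) Malcev completion of the torsion-free nilpotent group `G`: it embeds
`G` in a torsion-free nilpotent group `M` that has all roots and in which every element has a
positive power in the image of `G`. These properties determine `M` up to a unique isomorphism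
over `G`. -/
structure IsMalcevCompletion {G M : Type*} [Group G] [Group M] (ι : G →* M) : Prop where
  nilpotent : Group.IsNilpotent M
  torsionFree : TorsionFreeGroup M
  exists_root : ∀ (n : ℕ), 0 < n → ∀ x : M, ∃ y : M, y ^ n = x
  injective : Function.Injective ι
  exists_pow_mem : ∀ x : M, ∃ n : ℕ, 0 < n ∧ x ^ n ∈ ι.range

/-!
Strong recurrence yields, for each `m > 0`, an injective endomorphism `φ` of `G` whose image has
finite index and consists of `m`-th powers of elements of `G`
(`IsStronglyRecurrentSelfSimilar.exists_isDeepEmbedding`). Indeed a Noetherian nilpotent group has a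
finite-index subgroup `H` consisting of `m`-th powers (`exists_finiteIndex_forall_eq_pow`), and a
surjection `f : K → G` with `K ≤ H` is injective because `G` is Noetherian
(`injective_of_surjective_virtualEndo`), so that `φ = f⁻¹` is such an endomorphism. Simplicity of `f`
plays no role. Two consequences give the theorem.

*Existence of the completion.* The direct limit of `G → G → ⋯` along endomorphisms `φᵢ` with values
in the `(i + 1)!`-th powers has all roots. It is nilpotent and torsion-free as `G` is, and
every element has a positive power in the first copy of `G`, because the images have finite index
(`CompatibleGerms.isMalcevCompletion`).

*Geometric equivalence.* It suffices that homomorphisms `F → M` and `F → G` have the same kernels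
(`IsMalcevCompletion.exists_ker_eq`). Given `σ : F → M`, take `m` with `σ xᵢ ^ m ∈ G` for the free
generators `xᵢ`, the endomorphism `φ` for this `m`, and `τ : F → G` with `τ xᵢ ^ m = φ (σ xᵢ ^ m)`.
The graph of `φ` contains a positive power of each `(σ xᵢ, τ xᵢ)`, hence of each `(σ w, τ w)`,
since in a nilpotent group the elements with a positive power in a given subgroup form a subgroup
(`Group.IsNilpotent.exists_pow_mem`). As `φ` is injective and both groups are torsion-free,
`ker τ = ker σ`.
-/

open scoped commutatorElement

/-! ### Subgroups of finitely generated nilpotent groups -/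

/-- The ascending chain condition on subgroups passes to group extensions. -/
theorem wellFoundedGT_subgroup_of_extension {G : Type*} [Group G] (N : Subgroup G) [N.Normal]
    [WellFoundedGT (Subgroup N)] [WellFoundedGT (Subgroup (G ⧸ N))] :
    WellFoundedGT (Subgroup G) := by
  have hmono : StrictMono fun H : Subgroup G =>
      (H.subgroupOf N, H.map (QuotientGroup.mk' N)) := by
    intro H H' hlt
    refine lt_of_le_of_ne ⟨Subgroup.comap_mono hlt.le, Subgroup.map_mono hlt.le⟩ fun heq => ?_
    obtain ⟨h₁, h₂⟩ := Prod.mk.inj heq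
    refine hlt.not_ge fun x hx => ?_
    have hx' : QuotientGroup.mk' N x ∈ H.map (QuotientGroup.mk' N) :=
      h₂ ▸ Subgroup.mem_map_of_mem _ hx
    obtain ⟨y, hy, hxy⟩ := hx'
    have hyx : y⁻¹ * x ∈ N := QuotientGroup.eq.mp hxy
    have : (⟨y⁻¹ * x, hyx⟩ : N) ∈ H.subgroupOf N := by
      rw [h₁]
      exact H'.mul_mem (H'.inv_mem (hlt.le hy)) hx
    simpa using H.mul_mem hy (Subgroup.mem_subgroupOf.mp this)
  exact hmono.wellFoundedGT

theorem CommGroup.wellFoundedGT_subgroup {A : Type*} [CommGroup A] [Group.FG A] :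
    WellFoundedGT (Subgroup A) := by
  have : Module.Finite ℤ (Additive A) := Module.Finite.iff_addGroup_fg.mpr inferInstance
  have : WellFoundedGT (Submodule ℤ (Additive A)) := inferInstance
  let e := (Subgroup.toAddSubgroup (G := A)).trans AddSubgroup.toIntSubmodule
  exact e.strictMono.wellFoundedGT

/-- Under the ascending chain condition a maximal finitely generated subgroup of `H` is `H`. -/
theorem Subgroup.fg_of_wellFoundedGT {G : Type*} [Group G] [WellFoundedGT (Subgroup G)]
    (H : Subgroup G) : H.FG := by
  obtain ⟨M, ⟨hMH, hM⟩, hmax⟩ := wellFounded_gt.has_min {M : Subgroup G | M ≤ H ∧ M.FG}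
    ⟨⊥, bot_le, Subgroup.FG.bot⟩
  suffices H ≤ M from le_antisymm hMH this ▸ hM
  intro x hx
  have hle : M ⊔ Subgroup.zpowers x ≤ H := sup_le hMH (Subgroup.zpowers_le.mpr hx)
  have hfg : (M ⊔ Subgroup.zpowers x).FG :=
    hM.sup ⟨{x}, by simp [Subgroup.zpowers_eq_closure]⟩
  by_contra hxM
  refine hmax _ ⟨hle, hfg⟩ (lt_of_le_of_ne le_sup_left fun h => hxM ?_)
  rw [h]
  exact Subgroup.mem_sup_right (Subgroup.mem_zpowers x)

theorem Subgroup.normal_of_le_center {G : Type*} [Group G] {H : Subgroup G}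
    (h : H ≤ Subgroup.center G) : H.Normal :=
  ⟨fun x hx g => by rwa [Subgroup.mem_center_iff.mp (h hx) g, mul_inv_cancel_right]⟩

theorem lowerCentralSeries_le_center {G : Type*} [Group G] {n : ℕ}
    (h : (⊤ : Subgroup G).lowerCentralSeries (n + 1) = ⊥) :
    (⊤ : Subgroup G).lowerCentralSeries n ≤ Subgroup.center G := by
  intro a ha
  rw [Subgroup.mem_center_iff]
  intro g
  have : ⁅a, g⁆ ∈ (⊤ : Subgroup G).lowerCentralSeries (n + 1) :=
    Subgroup.commutator_mem_commutator ha (Subgroup.mem_top g)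
  rw [h, Subgroup.mem_bot, commutatorElement_eq_one_iff_mul_comm] at this
  exact this.symm

theorem lowerCentralSeries_quotient_eq_bot {G : Type*} [Group G] (n : ℕ) :
    (⊤ : Subgroup (G ⧸ (⊤ : Subgroup G).lowerCentralSeries n)).lowerCentralSeries n = ⊥ := by
  have := Subgroup.map_lowerCentralSeries (⊤ : Subgroup G)
    (QuotientGroup.mk' ((⊤ : Subgroup G).lowerCentralSeries n)) n
  rw [Subgroup.map_top_of_surjective _ (QuotientGroup.mk'_surjective _)] at this
  rw [← this, Subgroup.map_eq_bot_iff, QuotientGroup.ker_mk']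

/-- If `γₙ₊₁` is finitely generated modulo the central subgroup `γₙ₊₂`, then `γₙ₊₂` is generated by
the commutators of such generators with generators of `G`, because `⁅u, x⁆` is bilinear there.
(Indices are shifted: `lowerCentralSeries 0` is the whole group.) -/
theorem lowerCentralSeries_fg {G : Type*} [Group G] [Group.FG G] {n : ℕ}
    (h : (⊤ : Subgroup G).lowerCentralSeries (n + 1) ≤ Subgroup.center G)
    (hfg : (((⊤ : Subgroup G).lowerCentralSeries n).map
      (QuotientGroup.mk' ((⊤ : Subgroup G).lowerCentralSeries (n + 1)))).FG) :
    ((⊤ : Subgroup G).lowerCentralSeries (n + 1)).FG := by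
  classical
  set γ := (⊤ : Subgroup G).lowerCentralSeries
  obtain ⟨X, hX⟩ := Group.FG.out (G := G)
  obtain ⟨T, hT⟩ := hfg
  -- lift the generators of the image of `γ n` to `γ n`
  have hlift : ∀ t ∈ T, ∃ u ∈ γ n, QuotientGroup.mk' (γ (n + 1)) u = t := by
    intro t ht
    have : t ∈ Subgroup.closure (T : Set (G ⧸ γ (n + 1))) := Subgroup.subset_closure ht
    rw [hT] at this
    exact this
  choose! u hu hut using hlift
  let C : Finset G := (T ×ˢ X).image fun p => ⁅u p.1, p.2⁆
  have hCle : Subgroup.closure (C : Set G) ≤ γ (n + 1) := by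
    rw [Subgroup.closure_le]
    intro c hc
    obtain ⟨⟨t, x⟩, htx, rfl⟩ := Finset.mem_image.mp (Finset.mem_coe.mp hc)
    exact Subgroup.commutator_mem_commutator (hu t (Finset.mem_product.mp htx).1)
      (Subgroup.mem_top x)
  have hCn : (Subgroup.closure (C : Set G)).Normal :=
    Subgroup.normal_of_le_center (hCle.trans h)
  refine ⟨C, le_antisymm hCle ?_⟩
  let π := QuotientGroup.mk' (Subgroup.closure (C : Set G))
  -- the subgroup of elements that are central modulo the commutators in `C`
  let U := (Subgroup.center (G ⧸ Subgroup.closure (C : Set G))).comap π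
  have hAU : γ (n + 1) ≤ U := fun a ha => by
    refine Subgroup.mem_center_iff.mpr fun g => ?_
    obtain ⟨g, rfl⟩ := QuotientGroup.mk'_surjective _ g
    rw [← map_mul, ← map_mul, Subgroup.mem_center_iff.mp (h ha) g]
  have huU : ∀ t ∈ T, u t ∈ U := fun t ht => by
    have hcent : (⊤ : Subgroup G) ≤ (Subgroup.centralizer {π (u t)}).comap π := by
      rw [← hX, Subgroup.closure_le]
      intro x hx
      have hmem : ⁅u t, x⁆ ∈ Subgroup.closure (C : Set G) :=
        Subgroup.subset_closure (Finset.mem_coe.mpr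
          (Finset.mem_image.mpr ⟨(t, x), Finset.mem_product.mpr ⟨ht, hx⟩, rfl⟩))
      have h1 : ⁅π (u t), π x⁆ = 1 := by
        rw [← map_commutatorElement]
        exact (QuotientGroup.eq_one_iff _).mpr hmem
      rw [SetLike.mem_coe, Subgroup.mem_comap, Subgroup.mem_centralizer_singleton_iff]
      exact (commutatorElement_eq_one_iff_mul_comm.mp h1).symm
    refine Subgroup.mem_center_iff.mpr fun g => ?_
    obtain ⟨g, rfl⟩ := QuotientGroup.mk'_surjective _ g
    exact Subgroup.mem_centralizer_singleton_iff.mp (hcent (Subgroup.mem_top g))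
  have hγU : γ n ≤ U := by
    intro v hv
    have hTU : (γ n).map (QuotientGroup.mk' (γ (n + 1))) ≤
        U.map (QuotientGroup.mk' (γ (n + 1))) := by
      rw [← hT, Subgroup.closure_le]
      exact fun t ht => ⟨u t, huU t ht, hut t ht⟩
    obtain ⟨w, hw, hwv⟩ := hTU (Subgroup.mem_map_of_mem _ hv)
    have := U.mul_mem hw (hAU (QuotientGroup.eq.mp hwv))
    simpa using this
  refine Subgroup.commutator_le.mpr fun v hv g _ => ?_
  have := Subgroup.mem_center_iff.mp (hγU hv) (π g)
  rw [← QuotientGroup.eq_one_iff]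
  change π ⁅v, g⁆ = 1
  rw [map_commutatorElement, commutatorElement_eq_one_iff_mul_comm]
  exact this.symm

theorem wellFoundedGT_subgroup_of_lowerCentralSeries_eq_bot {n : ℕ} :
    ∀ {G : Type*} [Group G] [Group.FG G], (⊤ : Subgroup G).lowerCentralSeries n = ⊥ →
      WellFoundedGT (Subgroup G) := by
  induction n with
  | zero =>
    intro G _ _ h
    have : Subsingleton G := Subgroup.subsingleton_iff.mp (subsingleton_of_bot_eq_top h.symm)
    infer_instance
  | succ n ih =>
    intro G _ _ h
    have hQ := ih (lowerCentralSeries_quotient_eq_bot (G := G) n)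
    have hcen := lowerCentralSeries_le_center h
    have hfg : ((⊤ : Subgroup G).lowerCentralSeries n).FG := by
      cases n with
      | zero => exact Group.FG.out
      | succ k => exact lowerCentralSeries_fg hcen (Subgroup.fg_of_wellFoundedGT _)
    have : Group.FG ((⊤ : Subgroup G).lowerCentralSeries n) := Group.fg_iff_subgroup_fg _ |>.mpr hfg
    let _ : CommGroup ((⊤ : Subgroup G).lowerCentralSeries n) :=
      { mul_comm := fun a b => Subtype.ext (Subgroup.mem_center_iff.mp (hcen b.2) a) }
    have := CommGroup.wellFoundedGT_subgroup (A := (⊤ : Subgroup G).lowerCentralSeries n)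
    exact wellFoundedGT_subgroup_of_extension ((⊤ : Subgroup G).lowerCentralSeries n)

theorem Group.IsNilpotent.wellFoundedGT_subgroup (G : Type*) [Group G] [Group.FG G]
    [hG : Group.IsNilpotent G] : WellFoundedGT (Subgroup G) := by
  obtain ⟨n, hn⟩ := Subgroup.nilpotent_iff_lowerCentralSeries.mp hG
  exact wellFoundedGT_subgroup_of_lowerCentralSeries_eq_bot hn

/-- A surjection onto `G` from a subgroup of a Noetherian group `G` is injective: the subgroups
`N₀ = 1`, `Nᵢ₊₁ = f⁻¹(Nᵢ)` ascend, and if `Nᵢ₊₂ = Nᵢ₊₁` then applying `f` gives `Nᵢ₊₁ = Nᵢ`. -/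
theorem injective_of_surjective_virtualEndo {G : Type*} [Group G] [WellFoundedGT (Subgroup G)]
    {K : Subgroup G} (f : K →* G) (hf : Function.Surjective f) : Function.Injective f := by
  let N : ℕ → Subgroup G := fun i => Nat.rec ⊥ (fun _ M => (M.comap f).map K.subtype) i
  have hsucc : ∀ i, N (i + 1) = ((N i).comap f).map K.subtype := fun _ => rfl
  have hmono : Monotone N := by
    refine monotone_nat_of_le_succ fun i => ?_
    induction i with
    | zero => exact bot_le
    | succ i ih =>
      rw [hsucc, hsucc (i + 1)]
      exact Subgroup.map_mono (Subgroup.comap_mono ih)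
  have hinj : ∀ M M' : Subgroup G, (M.comap f).map K.subtype = (M'.comap f).map K.subtype →
      M = M' := fun M M' h =>
    Subgroup.comap_injective hf (Subgroup.map_injective K.subtype_injective h)
  obtain ⟨n, hn⟩ := WellFoundedGT.monotone_chain_condition ⟨N, hmono⟩
  have hback : ∀ n, N n = N (n + 1) → N 0 = N 1 := by
    intro n
    induction n with
    | zero => exact id
    | succ n ih => exact fun h => ih (hinj _ _ h)
  have h01 : N 1 = ⊥ := (hback n (hn (n + 1) n.le_succ)).symm
  rw [← MonoidHom.ker_eq_bot_iff]
  exact (Subgroup.map_eq_bot_iff_of_injective _ K.subtype_injective).mp h01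

/-! ### Powers lying in a subgroup of a nilpotent group -/

theorem commutatorElement_pow_pow {G : Type*} [Group G] {u v : G}
    (h : ⁅u, v⁆ ∈ Subgroup.center G) (i j : ℕ) : ⁅u ^ i, v ^ j⁆ = ⁅u, v⁆ ^ (i * j) := by
  have hc : ∀ g, Commute ⁅u, v⁆ g := fun g => (Subgroup.mem_center_iff.mp h g).symm
  have hi : u ^ i * v * (u ^ i)⁻¹ = ⁅u, v⁆ ^ i * v := by
    induction i with
    | zero => simp
    | succ i ih =>
      calc u ^ (i + 1) * v * (u ^ (i + 1))⁻¹ = u * (u ^ i * v * (u ^ i)⁻¹) * u⁻¹ := by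
            rw [pow_succ']; group
        _ = u * ⁅u, v⁆ ^ i * v * u⁻¹ := by rw [ih]; group
        _ = ⁅u, v⁆ ^ i * (u * v * u⁻¹) := by rw [← ((hc u).pow_left i).eq]; group
        _ = ⁅u, v⁆ ^ i * (⁅u, v⁆ * v) := by rw [commutatorElement_def]; group
        _ = ⁅u, v⁆ ^ (i + 1) * v := by rw [← mul_assoc, ← pow_succ]
  rw [commutatorElement_def, ← conj_pow, hi, ((hc v).pow_left i).mul_pow, ← pow_mul,
    mul_inv_cancel_right]

theorem exists_pow_mem_of_mem_closure_center {G : Type*} [Group G] {T : Set G}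
    (hT : T ⊆ Subgroup.center G) (Γ : Subgroup G) (h : ∀ t ∈ T, ∃ k : ℕ, 0 < k ∧ t ^ k ∈ Γ)
    {a : G} (ha : a ∈ Subgroup.closure T) : ∃ k : ℕ, 0 < k ∧ a ^ k ∈ Γ := by
  have hcl : Subgroup.closure T ≤ Subgroup.center G := (Subgroup.closure_le _).mpr hT
  induction ha using Subgroup.closure_induction with
  | mem t ht => exact h t ht
  | one => exact ⟨1, one_pos, by simp⟩
  | inv x _ ih =>
    obtain ⟨k, hk, hx⟩ := ih
    exact ⟨k, hk, by simpa using Γ.inv_mem hx⟩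
  | mul x y _ hy ihx ihy =>
    obtain ⟨k, hk, hxk⟩ := ihx
    obtain ⟨l, hl, hyl⟩ := ihy
    refine ⟨k * l, Nat.mul_pos hk hl, ?_⟩
    have hxy : Commute x y := Subgroup.mem_center_iff.mp (hcl hy) x
    rw [hxy.mul_pow, pow_mul, mul_comm k l, pow_mul]
    exact Γ.mul_mem (Γ.pow_mem hxk l) (Γ.pow_mem hyl k)

theorem exists_pow_mem_of_lowerCentralSeries_eq_bot {n : ℕ} :
    ∀ {G : Type*} [Group G], (⊤ : Subgroup G).lowerCentralSeries n = ⊥ →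
      ∀ {S : Set G}, Subgroup.closure S = ⊤ → ∀ Γ : Subgroup G,
      (∀ s ∈ S, ∃ k : ℕ, 0 < k ∧ s ^ k ∈ Γ) → ∀ p : G, ∃ k : ℕ, 0 < k ∧ p ^ k ∈ Γ := by
  induction n with
  | zero =>
    intro G _ h S _ Γ _ p
    refine ⟨1, one_pos, ?_⟩
    have hp : p ∈ (⊥ : Subgroup G) := h ▸ Subgroup.mem_top p
    rw [Subgroup.mem_bot.mp hp, one_pow]
    exact Γ.one_mem
  | succ n ih =>
    intro G _ h S hS Γ hΓ
    set γ := (⊤ : Subgroup G).lowerCentralSeries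
    have hcen := lowerCentralSeries_le_center h
    let π := QuotientGroup.mk' (γ n)
    have hquot : ∀ p, ∃ k : ℕ, 0 < k ∧ ∃ g ∈ Γ, ∃ a ∈ γ n, p ^ k = g * a := by
      intro p
      have hS' : Subgroup.closure (π '' S) = ⊤ := by
        rw [← MonoidHom.map_closure, hS]
        exact Subgroup.map_top_of_surjective _ (QuotientGroup.mk'_surjective _)
      obtain ⟨k, hk, g, hg, hgp⟩ := ih (lowerCentralSeries_quotient_eq_bot n) hS' (Γ.map π)
        (by
          rintro _ ⟨s, hs, rfl⟩
          obtain ⟨k, hk, hsk⟩ := hΓ s hs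
          exact ⟨k, hk, s ^ k, hsk, map_pow π s k⟩) (π p)
      rw [← map_pow] at hgp
      exact ⟨k, hk, g, hg, g⁻¹ * p ^ k, QuotientGroup.eq.mp hgp, by group⟩
    have hA : ∀ a ∈ γ n, ∃ k : ℕ, 0 < k ∧ a ^ k ∈ Γ := by
      cases n with
      | zero =>
        intro a _
        refine exists_pow_mem_of_mem_closure_center (T := S) (fun s _ => hcen (Subgroup.mem_top s))
          Γ hΓ ?_
        rw [hS]
        exact Subgroup.mem_top a
      | succ m =>
        intro a ha
        refine exists_pow_mem_of_mem_closure_center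
          (T := {x | ∃ u ∈ γ m, ∃ v ∈ (⊤ : Subgroup G), ⁅u, v⁆ = x}) ?_ Γ ?_ ha
        · rintro _ ⟨u, hu, v, hv, rfl⟩
          exact hcen (Subgroup.commutator_mem_commutator hu hv)
        · rintro _ ⟨u, hu, v, hv, rfl⟩
          obtain ⟨i, hi, g, hg, a, ha, hua⟩ := hquot u
          obtain ⟨j, hj, g', hg', b, hb, hvb⟩ := hquot v
          refine ⟨i * j, Nat.mul_pos hi hj, ?_⟩
          have ha' := Subgroup.mem_center_iff.mp (hcen ha)
          have hb' := Subgroup.mem_center_iff.mp (hcen hb)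
          rw [← commutatorElement_pow_pow (hcen (Subgroup.commutator_mem_commutator hu hv)),
            hua, hvb]
          -- central factors do not change a commutator
          have : ⁅g * a, g' * b⁆ = ⁅g, g'⁆ := by
            simp only [commutatorElement_def, mul_inv_rev]
            calc g * a * (g' * b) * (a⁻¹ * g⁻¹) * (b⁻¹ * g'⁻¹)
                = g * (a * (g' * b)) * (a⁻¹ * g⁻¹) * (b⁻¹ * g'⁻¹) := by group
              _ = g * ((g' * b) * a) * (a⁻¹ * g⁻¹) * (b⁻¹ * g'⁻¹) := by rw [ha' (g' * b)]
              _ = g * g' * (b * g⁻¹) * (b⁻¹ * g'⁻¹) := by group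
              _ = g * g' * (g⁻¹ * b) * (b⁻¹ * g'⁻¹) := by rw [hb' g⁻¹]
              _ = g * g' * g⁻¹ * g'⁻¹ := by group
          rw [this, commutatorElement_def]
          exact Γ.mul_mem (Γ.mul_mem (Γ.mul_mem hg hg') (Γ.inv_mem hg)) (Γ.inv_mem hg')
    intro p
    obtain ⟨k, hk, g, hg, a, ha, hpa⟩ := hquot p
    obtain ⟨r, hr, har⟩ := hA a ha
    refine ⟨k * r, Nat.mul_pos hk hr, ?_⟩
    have hga : Commute g a := Subgroup.mem_center_iff.mp (hcen ha) g
    rw [pow_mul, hpa, hga.mul_pow]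
    exact Γ.mul_mem (Γ.pow_mem hg r) har

/-- In a nilpotent group generated by `S`, if every element of `S` has a positive power in `Γ`, then
so does every element of the group. -/
theorem Group.IsNilpotent.exists_pow_mem {G : Type*} [Group G] [hG : Group.IsNilpotent G]
    {S : Set G} (hS : Subgroup.closure S = ⊤) (Γ : Subgroup G)
    (h : ∀ s ∈ S, ∃ k : ℕ, 0 < k ∧ s ^ k ∈ Γ) (p : G) : ∃ k : ℕ, 0 < k ∧ p ^ k ∈ Γ := by
  obtain ⟨n, hn⟩ := Subgroup.nilpotent_iff_lowerCentralSeries.mp hG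
  exact exists_pow_mem_of_lowerCentralSeries_eq_bot hn hS Γ h p

/-! ### A finite-index subgroup consisting of `m`-th powers -/

theorem WellFoundedGT.subgroup_quotient {G : Type*} [Group G] [WellFoundedGT (Subgroup G)]
    (N : Subgroup G) [N.Normal] : WellFoundedGT (Subgroup (G ⧸ N)) := by
  have : StrictMono fun H : Subgroup (G ⧸ N) => H.comap (QuotientGroup.mk' N) :=
    Monotone.strictMono_of_injective (fun _ _ h => Subgroup.comap_mono h)
      (Subgroup.comap_injective (QuotientGroup.mk'_surjective N))
  exact this.wellFoundedGT

/-- A Noetherian nilpotent group with torsion centre is finite. If the exponent of the centre is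
`e`, then `⁅x ^ e, y⁆ = ⁅x, y⁆ ^ e = 1` whenever `x` is central modulo the centre, so that the
hypothesis passes to the quotient by the centre. -/
theorem Group.IsNilpotent.finite_of_isOfFinOrder_center (G : Type*) [Group G]
    [Group.IsNilpotent G] : WellFoundedGT (Subgroup G) →
      (∀ z ∈ Subgroup.center G, IsOfFinOrder z) → Finite G := by
  refine Group.nilpotent_center_quotient_ind (P := fun G _ _ => WellFoundedGT (Subgroup G) →
    (∀ z ∈ Subgroup.center G, IsOfFinOrder z) → Finite G) G ?_ ?_
  · exact fun G _ _ _ _ => inferInstance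
  · intro G _ _ ih hwf htor
    have hfg : Group.FG (Subgroup.center G) :=
      (Group.fg_iff_subgroup_fg _).mpr (Subgroup.fg_of_wellFoundedGT _)
    let _ : CommGroup (Subgroup.center G) :=
      { mul_comm := fun a b => Subtype.ext (Subgroup.mem_center_iff.mp b.2 a) }
    have hfin : Finite (Subgroup.center G) :=
      CommGroup.finite_of_fg_isMulTorsion _ fun z => Submonoid.isOfFinOrder_coe.mp (htor z z.2)
    have hQ : Finite (G ⧸ Subgroup.center G) := by
      refine ih (WellFoundedGT.subgroup_quotient _) fun z hz => ?_
      obtain ⟨x, rfl⟩ := QuotientGroup.mk'_surjective _ z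
      have hcomm : ∀ y, ⁅x, y⁆ ∈ Subgroup.center G := fun y => by
        rw [← QuotientGroup.eq_one_iff]
        change QuotientGroup.mk' _ ⁅x, y⁆ = 1
        rw [map_commutatorElement, commutatorElement_eq_one_iff_mul_comm]
        exact (Subgroup.mem_center_iff.mp hz _).symm
      refine isOfFinOrder_iff_pow_eq_one.mpr ⟨Nat.card (Subgroup.center G), Nat.card_pos, ?_⟩
      rw [← map_pow]
      refine (QuotientGroup.eq_one_iff _).mpr (Subgroup.mem_center_iff.mpr fun y => ?_)
      have h1 : ⁅x ^ Nat.card (Subgroup.center G), y ^ 1⁆ = 1 := by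
        rw [commutatorElement_pow_pow (hcomm y), mul_one]
        exact congrArg Subtype.val (pow_card_eq_one' (x := (⟨_, hcomm y⟩ : Subgroup.center G)))
      rw [pow_one, commutatorElement_eq_one_iff_mul_comm] at h1
      exact h1.symm
    exact Finite.of_subgroup_quotient (Subgroup.center G)

/-- A form of residual finiteness: some normal subgroup `L` of finite index meets the central
subgroup `A` in `m`-th powers of `A` only. A maximal normal `L` with this property works: if some
`z` had infinite order in the centre of `G ⧸ L`, then enlarging `L` by `z` adds some
`a ∈ A`, `a = z ^ i` modulo `L`, which is not an `m`-th power, and enlarging `L` by `z ^ (i * m)`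
adds only `m`-th powers. -/
theorem exists_normal_finiteIndex_inf_le_pow {G : Type*} [Group G] [Group.IsNilpotent G]
    [WellFoundedGT (Subgroup G)] {A : Subgroup G} (hA : A ≤ Subgroup.center G) {m : ℕ}
    (hm : 0 < m) :
    ∃ L : Subgroup G, L.Normal ∧ L.FiniteIndex ∧ ∀ x ∈ L, x ∈ A → ∃ w ∈ A, w ^ m = x := by
  obtain ⟨L, ⟨hLn, hLA⟩, hmax⟩ := wellFounded_gt.has_min
    {L : Subgroup G | L.Normal ∧ ∀ x ∈ L, x ∈ A → ∃ w ∈ A, w ^ m = x}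
    ⟨⊥, inferInstance, fun x hx _ => ⟨1, A.one_mem, by rw [Subgroup.mem_bot.mp hx, one_pow]⟩⟩
  refine ⟨L, hLn, ?_, hLA⟩
  let π := QuotientGroup.mk' L
  have hπ : ∀ x, π x = 1 ↔ x ∈ L := fun x => QuotientGroup.eq_one_iff x
  suffices Finite (G ⧸ L) from L.finiteIndex_of_finite_quotient
  refine Group.IsNilpotent.finite_of_isOfFinOrder_center _ (WellFoundedGT.subgroup_quotient L) ?_
  intro z hz
  by_contra hinf
  -- a non-trivial power of `z` agrees modulo `L` with an element of `A` that is no `m`-th power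
  have key : ∀ k : ℤ, k ≠ 0 → ∃ a ∈ A, (∃ i : ℤ, (z ^ k) ^ i = π a) ∧ ¬ ∃ w ∈ A, w ^ m = a := by
    intro k hk
    have hcen : Subgroup.zpowers (z ^ k) ≤ Subgroup.center (G ⧸ L) :=
      Subgroup.zpowers_le.mpr (Subgroup.zpow_mem _ hz k)
    have hn : (Subgroup.zpowers (z ^ k)).Normal := Subgroup.normal_of_le_center hcen
    have hlt : L < (Subgroup.zpowers (z ^ k)).comap π := by
      refine lt_of_le_of_ne (fun x hx => ?_) fun heq => ?_
      · rw [Subgroup.mem_comap, (hπ x).mpr hx]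
        exact Subgroup.one_mem _
      · obtain ⟨y, hy⟩ := QuotientGroup.mk'_surjective L (z ^ k)
        have hyL : y ∈ L := by
          rw [heq, Subgroup.mem_comap]
          exact hy ▸ Subgroup.mem_zpowers _
        have h1 : z ^ k = 1 := hy.symm.trans ((hπ y).mpr hyL)
        exact hinf (isOfFinOrder_iff_zpow_eq_one.mpr ⟨k, hk, h1⟩)
    by_contra hcon
    push Not at hcon
    refine hmax _ ⟨hn.comap π, fun x hx hxA => ?_⟩ hlt
    exact hcon x hxA (Subgroup.mem_zpowers_iff.mp hx)
  obtain ⟨a, haA, ⟨i, hi⟩, hpow⟩ := key 1 one_ne_zero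
  rw [zpow_one] at hi
  have hi0 : i ≠ 0 := by
    rintro rfl
    rw [zpow_zero] at hi
    exact hpow (hLA a ((hπ a).mp hi.symm) haA)
  obtain ⟨b, hbA, ⟨j, hj⟩, hb⟩ := key (i * m) (mul_ne_zero hi0 (by exact_mod_cast hm.ne'))
  have hbL : ((a ^ j) ^ m)⁻¹ * b ∈ L := by
    rw [← hπ, map_mul, map_inv, map_pow, map_zpow, ← hi, ← hj, inv_mul_eq_one, ← zpow_natCast,
      ← zpow_mul, ← zpow_mul, ← zpow_mul]
    congr 1
    ring
  obtain ⟨w, hw, hwb⟩ := hLA _ hbL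
    (A.mul_mem (A.inv_mem (A.pow_mem (A.zpow_mem haA j) m)) hbA)
  refine hb ⟨a ^ j * w, A.mul_mem (A.zpow_mem haA j) hw, ?_⟩
  have hc : Commute (a ^ j) w := Subgroup.mem_center_iff.mp (hA hw) _
  rw [hc.mul_pow, hwb, mul_inv_cancel_left]

/-- In a Noetherian nilpotent group some finite-index subgroup consists of `m`-th powers. -/
theorem exists_finiteIndex_forall_eq_pow (G : Type*) [Group G] [Group.IsNilpotent G] :
    WellFoundedGT (Subgroup G) → ∀ m : ℕ, 0 < m →
      ∃ H : Subgroup G, H.FiniteIndex ∧ ∀ h ∈ H, ∃ g, g ^ m = h := by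
  refine Group.nilpotent_center_quotient_ind (P := fun G _ _ => WellFoundedGT (Subgroup G) →
    ∀ m : ℕ, 0 < m → ∃ H : Subgroup G, H.FiniteIndex ∧ ∀ h ∈ H, ∃ g, g ^ m = h) G ?_ ?_
  · exact fun G _ _ _ m _ => ⟨⊤, inferInstance, fun h _ => ⟨1, Subsingleton.elim _ _⟩⟩
  · intro G _ _ ih hwf m hm
    obtain ⟨L, hLn, hLi, hL⟩ := exists_normal_finiteIndex_inf_le_pow (le_refl (Subgroup.center G)) hm
    have hN : 0 < L.index := Nat.pos_of_ne_zero hLi.index_ne_zero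
    obtain ⟨H, hHi, hH⟩ := ih (WellFoundedGT.subgroup_quotient _) (L.index * m) (Nat.mul_pos hN hm)
    have hHc : (H.comap (QuotientGroup.mk' (Subgroup.center G))).FiniteIndex := by
      rw [Subgroup.finiteIndex_iff,
        H.index_comap_of_surjective (QuotientGroup.mk'_surjective _)]
      exact hHi.index_ne_zero
    refine ⟨H.comap (QuotientGroup.mk' _) ⊓ L, inferInstance, fun h hh => ?_⟩
    obtain ⟨g, hg⟩ := hH _ hh.1
    obtain ⟨g, rfl⟩ := QuotientGroup.mk'_surjective _ g
    rw [← map_pow] at hg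
    have hz : (g ^ (L.index * m))⁻¹ * h ∈ Subgroup.center G := QuotientGroup.eq.mp hg
    -- `g ^ L.index ∈ L`, so the central factor `z` lies in `L` as well and is an `m`-th power
    have hzL : (g ^ (L.index * m))⁻¹ * h ∈ L := by
      rw [pow_mul]
      exact L.mul_mem (L.inv_mem (L.pow_mem (L.pow_index_mem g) m)) hh.2
    obtain ⟨w, hw, hwz⟩ := hL _ hzL hz
    have hc : Commute (g ^ L.index) w := Subgroup.mem_center_iff.mp hw _
    exact ⟨g ^ L.index * w, by rw [hc.mul_pow, hwz, ← pow_mul, mul_inv_cancel_left]⟩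

/-! ### Injective endomorphisms with values in the `m`-th powers -/

/-- An injective endomorphism whose image consists of `m`-th powers and contains a positive power
of every element. -/
structure IsDeepEmbedding {G : Type*} [Group G] (m : ℕ) (φ : G →* G) : Prop where
  injective : Function.Injective φ
  exists_pow_eq : ∀ g, ∃ h, h ^ m = φ g
  exists_pow_mem : ∀ g, ∃ k : ℕ, 0 < k ∧ g ^ k ∈ φ.range

/-- The endomorphism is the inverse of a surjection `f : K → G`, where `K` lies in a finite-index
subgroup consisting of `m`-th powers. -/
theorem IsStronglyRecurrentSelfSimilar.exists_isDeepEmbedding {G : Type*} [Group G] [Group.FG G]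
    [Group.IsNilpotent G] (hG : IsStronglyRecurrentSelfSimilar G) {m : ℕ} (hm : 0 < m) :
    ∃ φ : G →* G, IsDeepEmbedding m φ := by
  have hwf := Group.IsNilpotent.wellFoundedGT_subgroup G
  obtain ⟨H, hHi, hH⟩ := exists_finiteIndex_forall_eq_pow G hwf m hm
  obtain ⟨K, hKH, hKi, f, hf, -⟩ := hG H hHi
  let e : K ≃* G := MulEquiv.ofBijective f ⟨injective_of_surjective_virtualEndo f hf, hf⟩
  refine ⟨K.subtype.comp e.symm.toMonoidHom, ?_, fun g => hH _ (hKH (e.symm g).2), fun g => ?_⟩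
  · exact K.subtype_injective.comp e.symm.injective
  · obtain ⟨k, hk, -, hgk⟩ := Subgroup.exists_pow_mem_of_index_ne_zero hKi.index_ne_zero g
    exact ⟨k, hk, e ⟨g ^ k, hgk⟩, by simp⟩

/-! ### The Malcev completion as a direct limit -/

section Completion

variable {G : Type*} [Group G] (φ : ℕ → G →* G)

/-- The sequence that is `g` up to the index `i` and then satisfies `s (j + 1) = φ j (s j)`: the
germ at infinity of the `i`-th copy of `G` in the direct limit of `G → G → ⋯` along the `φ j`. -/
def compatibleSeq (i : ℕ) : ℕ → G →* G
  | 0 => MonoidHom.id G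
  | j + 1 => if j < i then compatibleSeq i j else (φ j).comp (compatibleSeq i j)

theorem compatibleSeq_of_le {i j : ℕ} (h : j ≤ i) (g : G) : compatibleSeq φ i j g = g := by
  induction j with
  | zero => rfl
  | succ j ih =>
    rw [compatibleSeq, if_pos (Nat.lt_of_succ_le h)]
    exact ih (Nat.le_of_succ_le h)

theorem compatibleSeq_succ {i j : ℕ} (h : i ≤ j) (g : G) :
    compatibleSeq φ i (j + 1) g = φ j (compatibleSeq φ i j g) := by
  rw [compatibleSeq, if_neg h.not_gt]
  rfl

variable {φ} in
theorem compatibleSeq_injective (hφ : ∀ i, Function.Injective (φ i)) (i j : ℕ) :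
    Function.Injective (compatibleSeq φ i j) := by
  induction j with
  | zero => exact Function.injective_id
  | succ j ih =>
    rw [compatibleSeq]
    split_ifs
    · exact ih
    · exact (hφ j).comp ih

/-- The subgroup of sequences in `G` that eventually satisfy `s (j + 1) = φ j (s j)`. -/
def eventuallyCompatible : Subgroup (ℕ → G) where
  carrier := {s | ∀ᶠ j in Filter.atTop, s (j + 1) = φ j (s j)}
  one_mem' := Filter.Eventually.of_forall fun j => (map_one (φ j)).symm
  mul_mem' := fun hs ht => by
    filter_upwards [hs, ht] with j h₁ h₂
    simp [h₁, h₂]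
  inv_mem' := fun hs => by
    filter_upwards [hs] with j h
    simp [h]

theorem compatibleSeq_mem (i : ℕ) (g : G) :
    (fun j => compatibleSeq φ i j g) ∈ eventuallyCompatible φ :=
  Filter.eventually_atTop.mpr ⟨i, fun _ hj => compatibleSeq_succ φ hj g⟩

/-- The direct limit of `G → G → ⋯` along the maps `φ j`, realised as the group of germs at infinity
of eventually compatible sequences. -/
abbrev CompatibleGerms : Type _ :=
  (eventuallyCompatible φ).map (Filter.Germ.coeMulHom (Filter.atTop : Filter ℕ))

/-- The `i`-th copy of `G` in the direct limit. -/
def CompatibleGerms.of (i : ℕ) : G →* CompatibleGerms φ where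
  toFun g := ⟨Filter.Germ.coeMulHom _ fun j => compatibleSeq φ i j g,
    Subgroup.mem_map_of_mem _ (compatibleSeq_mem φ i g)⟩
  map_one' := Subtype.ext <| by
    simp only [map_one]
    exact map_one (Filter.Germ.coeMulHom _)
  map_mul' a b := Subtype.ext <| by
    simp only [map_mul]
    exact map_mul (Filter.Germ.coeMulHom _) _ _

variable {φ}

theorem CompatibleGerms.of_eq_of_eventually {i i' : ℕ} {g g' : G}
    (h : ∀ᶠ j in Filter.atTop, compatibleSeq φ i j g = compatibleSeq φ i' j g') :
    of φ i g = of φ i' g' :=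
  Subtype.ext (Filter.Germ.coe_eq.mpr h)

theorem CompatibleGerms.of_succ (i : ℕ) (g : G) : of φ (i + 1) (φ i g) = of φ i g := by
  refine of_eq_of_eventually (Filter.eventually_atTop.mpr ⟨i + 1, fun j hj => ?_⟩)
  induction j, hj using Nat.le_induction with
  | base => rw [compatibleSeq_of_le φ le_rfl, compatibleSeq_succ φ le_rfl,
      compatibleSeq_of_le φ le_rfl]
  | succ j hj ih => rw [compatibleSeq_succ φ hj, compatibleSeq_succ φ (Nat.le_of_succ_le hj), ih]

theorem CompatibleGerms.exists_of (x : CompatibleGerms φ) : ∃ N, ∀ i ≥ N, ∃ g, of φ i g = x := by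
  obtain ⟨_, s, hs, rfl⟩ := x
  obtain ⟨N, hN⟩ := Filter.eventually_atTop.mp hs
  refine ⟨N, fun i hi => ⟨s i, Subtype.ext (Filter.Germ.coe_eq.mpr ?_)⟩⟩
  refine Filter.eventually_atTop.mpr ⟨i, fun j hj => ?_⟩
  induction j, hj using Nat.le_induction with
  | base => exact compatibleSeq_of_le φ le_rfl _
  | succ j hj ih =>
    dsimp only at ih ⊢
    rw [compatibleSeq_succ φ hj, ih, hN j (hi.trans hj)]

theorem CompatibleGerms.of_injective (hφ : ∀ i, Function.Injective (φ i)) (i : ℕ) :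
    Function.Injective (of φ i) := by
  intro g g' h
  obtain ⟨j, hj⟩ := (Filter.Germ.coe_eq.mp (congrArg Subtype.val h)).exists
  exact compatibleSeq_injective hφ i j hj

instance CompatibleGerms.isNilpotent [Group.IsNilpotent G] :
    Group.IsNilpotent (CompatibleGerms φ) := by
  have h₁ : Group.IsNilpotent (ℕ → G) :=
    Group.isNilpotent_pi_of_bounded_class (Group.nilpotencyClass G) fun _ => le_rfl
  have h₂ : Group.IsNilpotent (Filter.Germ (Filter.atTop : Filter ℕ) G) :=
    Group.nilpotent_of_surjective (Filter.Germ.coeMulHom _) Quotient.mk_surjective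
  infer_instance

/-- If the `i`-th map takes its values in `(i + 1)!`-th powers, the direct limit is divisible. -/
theorem CompatibleGerms.isMalcevCompletion [Group.IsNilpotent G] (htf : TorsionFreeGroup G)
    (hφ : ∀ i, IsDeepEmbedding (i + 1).factorial (φ i)) :
    IsMalcevCompletion (CompatibleGerms.of φ 0) where
  nilpotent := inferInstance
  torsionFree x hx := by
    obtain ⟨N, hN⟩ := exists_of x
    obtain ⟨g, rfl⟩ := hN N le_rfl
    rw [htf g ((of_injective (fun i => (hφ i).injective) N).isOfFinOrder_iff.mp hx), map_one]
  exists_root n hn x := by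
    obtain ⟨N, hN⟩ := exists_of x
    obtain ⟨g, rfl⟩ := hN (max N n) (le_max_left _ _)
    obtain ⟨h, hh⟩ := (hφ (max N n)).exists_pow_eq g
    obtain ⟨c, hc⟩ : n ∣ (max N n + 1).factorial :=
      Nat.dvd_factorial hn ((le_max_right _ _).trans (Nat.le_succ _))
    refine ⟨of φ (max N n + 1) (h ^ c), ?_⟩
    rw [← map_pow, ← pow_mul, mul_comm, ← hc, hh, of_succ]
  injective := of_injective (fun i => (hφ i).injective) 0
  exists_pow_mem x := by
    obtain ⟨N, hN⟩ := exists_of x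
    obtain ⟨g, rfl⟩ := hN N le_rfl
    clear hN
    induction N generalizing g with
    | zero => exact ⟨1, one_pos, g, by rw [pow_one]⟩
    | succ N ih =>
      obtain ⟨k, hk, g', hg'⟩ := (hφ N).exists_pow_mem g
      obtain ⟨l, hl, hmem⟩ := ih g'
      refine ⟨k * l, Nat.mul_pos hk hl, ?_⟩
      rwa [pow_mul, ← map_pow, ← hg', of_succ]

end Completion

/-! ### Geometric equivalence -/

/-- Homomorphisms from a finitely generated free group to the completion have the same kernels as
homomorphisms to `G`. If `m` is a common exponent with `σ xᵢ ^ m ∈ G`, choose `φ` with values in the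
`m`-th powers and let `τ xᵢ` be an `m`-th root of `φ (σ xᵢ ^ m)`; then `(σ w, τ w)` has a positive
power in the graph of `φ` for every word `w`, since this holds for `w = xᵢ`. -/
theorem IsMalcevCompletion.exists_ker_eq {G M : Type*} [Group G] [Group M] {ι : G →* M}
    [Group.IsNilpotent G] (htf : TorsionFreeGroup G) (hι : IsMalcevCompletion ι)
    (hφ : ∀ m : ℕ, 0 < m → ∃ φ : G →* G, IsDeepEmbedding m φ) {n : ℕ}
    (σ : FreeGroup (Fin n) →* M) : ∃ τ : FreeGroup (Fin n) →* G, τ.ker = σ.ker := by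
  have hM := hι.nilpotent
  choose k hk a ha using fun i => hι.exists_pow_mem (σ (FreeGroup.of i))
  let m := ∏ i, k i
  have hm : 0 < m := Finset.prod_pos fun i _ => hk i
  have hmk : ∀ i, k i ∣ m := fun i => Finset.dvd_prod_of_mem k (Finset.mem_univ i)
  obtain ⟨φ, hφm⟩ := hφ m hm
  have hg : ∀ i, ∃ g b, g ^ m = φ b ∧ ι b = σ (FreeGroup.of i) ^ m := fun i => by
    obtain ⟨c, hc⟩ := hmk i
    obtain ⟨g, hg⟩ := hφm.exists_pow_eq (a i ^ c)
    exact ⟨g, a i ^ c, hg, by rw [map_pow, ha, ← pow_mul, ← hc]⟩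
  choose g b hgb hb using hg
  let τ : FreeGroup (Fin n) →* G := FreeGroup.lift g
  let ρ := σ.prod τ
  let Γ : Subgroup (M × G) := (ι.prod φ).range
  have hgen : Subgroup.closure (Set.range fun i => ρ.rangeRestrict (FreeGroup.of i)) = ⊤ := by
    rw [Set.range_comp' ρ.rangeRestrict FreeGroup.of, ← MonoidHom.map_closure,
      FreeGroup.closure_range_of]
    exact Subgroup.map_top_of_surjective _ ρ.rangeRestrict_surjective
  have hpow : ∀ w, ∃ l : ℕ, 0 < l ∧ ρ w ^ l ∈ Γ := fun w => by
    refine Group.IsNilpotent.exists_pow_mem hgen (Γ.subgroupOf ρ.range) ?_ (ρ.rangeRestrict w)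
    rintro _ ⟨i, rfl⟩
    refine ⟨m, hm, b i, Prod.ext (hb i) ?_⟩
    change φ (b i) = τ (FreeGroup.of i) ^ m
    rw [FreeGroup.lift_apply_of, hgb]
  refine ⟨τ, SetLike.ext fun w => ?_⟩
  rw [MonoidHom.mem_ker, MonoidHom.mem_ker]
  obtain ⟨l, hl, c, hc⟩ := hpow w
  have hσ : ι c = σ w ^ l := congrArg Prod.fst hc
  have hτ : φ c = τ w ^ l := congrArg Prod.snd hc
  constructor <;> intro h
  · rw [h, one_pow, map_eq_one_iff φ hφm.injective] at hτ
    refine hι.torsionFree _ (isOfFinOrder_iff_pow_eq_one.mpr ⟨l, hl, ?_⟩)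
    rw [← hσ, hτ, map_one]
  · rw [h, one_pow, map_eq_one_iff ι hι.injective] at hσ
    refine htf _ (isOfFinOrder_iff_pow_eq_one.mpr ⟨l, hl, ?_⟩)
    rw [← hτ, hσ, map_one]

theorem commonKernel_homsKilling_subset {F G₁ G₂ : Type*} [Group F] [Group G₁] [Group G₂]
    (h : ∀ σ : F →* G₂, ∃ τ : F →* G₁, τ.ker = σ.ker) (S : Set F) :
    commonKernel (homsKilling G₁ S) ⊆ commonKernel (homsKilling G₂ S) := by
  intro w hw
  refine Set.mem_iInter₂.mpr fun σ hσ => ?_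
  obtain ⟨τ, hτ⟩ := h σ
  rw [← hτ]
  refine Set.mem_iInter₂.mp hw τ ?_
  change S ⊆ (τ.ker : Set F)
  rw [hτ]
  exact hσ

theorem theoremC (G : Type u) [Group G] (hfg : Group.FG G) (hnil : Group.IsNilpotent G)
    (htf : TorsionFreeGroup G) (hG : IsStronglyRecurrentSelfSimilar G) :
    (∃ (M : Type u) (_ : Group M) (ι : G →* M), IsMalcevCompletion ι) ∧
    (∀ (M : Type v) [Group M] (ι : G →* M), IsMalcevCompletion ι →
      GeometricallyEquivalent G M) := by
  constructor
  · choose φ hφ using fun i : ℕ => hG.exists_isDeepEmbedding (i + 1).factorial_pos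
    exact ⟨CompatibleGerms φ, inferInstance, CompatibleGerms.of φ 0,
      CompatibleGerms.isMalcevCompletion htf hφ⟩
  · intro M _ ι hι n S
    have hcl : commonKernel (homsKilling G S) = commonKernel (homsKilling M S) := by
      apply Set.Subset.antisymm
      · exact commonKernel_homsKilling_subset
          (hι.exists_ker_eq htf fun m hm => hG.exists_isDeepEmbedding hm) S
      · exact commonKernel_homsKilling_subset
          (fun σ => ⟨ι.comp σ, MonoidHom.ker_comp_of_injective σ ι hι.injective⟩) S
    rw [IsGroupClosed, IsGroupClosed, hcl]
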